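/- All Lie algebras are real. A Kähler structure on a finite-dimensional Lie algebra $\mathfrak g$ is a pair $(J,\omega)$, where $J$ is an endomorphism of $\mathfrak g$ with $J^2=-1$ and $[Jx,Jy]-[x,y]-J[Jx,y]-J[x,Jy]=0$ for all $x,y$, and $\omega$ is a nondegenerate alternating bilinear form with $\omega([x,y],z)+\omega([y,z],x)+\omega([z,x],y)=0$ and $\omega(Jx,Jy)=\omega(x,y)$ for all $x,y,z$. The associated symmetric nondegenerate form $g(x,y)=\omega(Jx,y)$, not necessarily definite, is called a pseudo-Kähler metric, and $\mathfrak g$ is called a Kähler Lie algebra if it admits a Kähler structure. The Levi-Civita connection $\nabla$ of $g$ is given by $2g(\nabla_xy,z)=g([x,y],z)-g([y,z],x)+g([z,x],y)$. Its curvature is $R(x,y)=[\nabla_x,\nabla_y]-\nabla_{[x,y]}$ and its Ricci tensor is $ric(x,y)=-\mathrm{tr}(v\mapsto R(x,v)y)$. The metric $g$ is flat if $R=0$ and Ricci flat if $ric=0$. The connection is complete if for every initial value the geodesic equation $\dot x(t)=-\nabla_{x(t)}x(t)$ in $\mathfrak g$ has a solution defined for all $t\in\mathbb R$. $\mathfrak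 g$ is unimodular if $\mathrm{tr}(\mathrm{ad}_x)=0$ for all $x\in\mathfrak g$. **Theorem.** Let $\mathfrak g$ be a four-dimensional real Lie algebra. 1. If $\mathfrak g$ is unimodular, then every pseudo-Kähler metric $g$ on $\mathfrak g$ is flat and its Levi-Civita connection is complete. In particular, if such a $g$ is Ricci flat, then it is flat. 2. $\mathfrak g$ is a unimodular Kähler Lie algebra if and only if it is abelian, or isomorphic to $\mathbb R\times\mathfrak h_3$, or isomorphic to $\mathbb R\times\mathfrak e(2)$. Here $\mathfrak h_3$ is the three-dimensional Heisenberg Lie algebra and $\mathfrak e(2)$ is the Lie algebra of the group of rigid motions of $\mathbb R^2$. -/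

import Mathlib

-- `ℝ` and matrix algebras carry the commutator bracket.
attribute [local instance 100] LieRing.ofAssociativeRing

noncomputable section

namespace PseudoKahler

/-! ### Kähler structures on a real Lie algebra -/

section Structures

variable {𝔤 : Type*} [LieRing 𝔤] [LieAlgebra ℝ 𝔤]

/-- A complex structure on `𝔤`: an endomorphism `J` with `J² = -1` and vanishing Nijenhuis
tensor. -/
structure IsComplexStructure (J : 𝔤 →ₗ[ℝ] 𝔤) : Prop where
  sq : ∀ x, J (J x) = -x
  integrable : ∀ x y, ⁅J x, J y⁆ - ⁅x, y⁆ - J ⁅J x, y⁆ - J ⁅x, J y⁆ = 0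

/-- A symplectic structure on `𝔤`: a closed 2-form of maximal rank. -/
structure IsSymplecticStructure (ω : LinearMap.BilinForm ℝ 𝔤) : Prop where
  alt : ∀ x, ω x x = 0
  closed : ∀ x y z, ω ⁅x, y⁆ z + ω ⁅y, z⁆ x + ω ⁅z, x⁆ y = 0
  nondegenerate : ω.Nondegenerate

/-- A Kähler structure on `𝔤`: a complex structure together with a compatible symplectic
structure. No definiteness is required. -/
structure IsKahlerStructure (J : 𝔤 →ₗ[ℝ] 𝔤) (ω : LinearMap.BilinForm ℝ 𝔤) : Prop where
  complex : IsComplexStructure J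
  symplectic : IsSymplecticStructure ω
  compatible : ∀ x y, ω (J x) (J y) = ω x y

/-- `g` is a pseudo-Kähler metric on `𝔤`: `g(x, y) = ω(Jx, y)` for some Kähler structure
`(J, ω)`. -/
def IsPseudoKahlerMetric (g : LinearMap.BilinForm ℝ 𝔤) : Prop :=
  ∃ (J : 𝔤 →ₗ[ℝ] 𝔤) (ω : LinearMap.BilinForm ℝ 𝔤),
    IsKahlerStructure J ω ∧ ∀ x y, g x y = ω (J x) y

variable (𝔤) in
/-- A Kähler Lie algebra is a Lie algebra that carries a Kähler structure. -/
def IsKahlerLieAlgebra : Prop :=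
  ∃ (J : 𝔤 →ₗ[ℝ] 𝔤) (ω : LinearMap.BilinForm ℝ 𝔤), IsKahlerStructure J ω

variable (𝔤) in
/-- `𝔤` is unimodular if `tr (ad x) = 0` for every `x`. -/
def IsUnimodular : Prop :=
  ∀ x : 𝔤, LinearMap.trace ℝ 𝔤 (LieAlgebra.ad ℝ 𝔤 x) = 0

/-- A pseudo-Kähler metric is symmetric. -/
theorem IsPseudoKahlerMetric.symm {g : LinearMap.BilinForm ℝ 𝔤} (hg : IsPseudoKahlerMetric g)
    (x y : 𝔤) : g x y = g y x := by
  obtain ⟨J, ω, h, hgω⟩ := hg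
  have hneg : ∀ u v, ω u v = -ω v u := fun u v => by
    have := h.symplectic.alt (u + v)
    simp only [map_add, LinearMap.add_apply, h.symplectic.alt] at this
    linarith
  rw [hgω, hgω, ← h.compatible, h.complex.sq, hneg]
  simp

/-- A pseudo-Kähler metric is nondegenerate. -/
theorem IsPseudoKahlerMetric.nondegenerate {g : LinearMap.BilinForm ℝ 𝔤}
    (hg : IsPseudoKahlerMetric g) : g.Nondegenerate := by
  have hs := hg.symm
  have hl : ∀ x, (∀ y, g x y = 0) → x = 0 := by
    obtain ⟨J, ω, h, hgω⟩ := hg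
    intro x hx
    have h0 : J x = 0 := h.symplectic.nondegenerate.1 _ fun y => by rw [← hgω]; exact hx y
    have := h.complex.sq x
    rw [h0, map_zero] at this
    simpa using this.symm
  exact ⟨hl, fun y hy => hl y fun x => by rw [hs]; exact hy x⟩

end Structures

/-! ### Left-invariant pseudo-Riemannian geometry at the level of the Lie algebra -/

section Geometry

variable {𝔤 : Type*} [LieRing 𝔤] [LieAlgebra ℝ 𝔤] [FiniteDimensional ℝ 𝔤]

/-- The linear form `z ↦ ½ (g([x,y],z) - g([y,z],x) + g([z,x],y))`. -/
def koszulForm (g : LinearMap.BilinForm ℝ 𝔤) (x y : 𝔤) : Module.Dual ℝ 𝔤 where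
  toFun z := (1 / 2 : ℝ) * (g ⁅x, y⁆ z - g ⁅y, z⁆ x + g ⁅z, x⁆ y)
  map_add' a b := by
    simp only [lie_add, add_lie, map_add, LinearMap.add_apply]; ring
  map_smul' c a := by
    simp only [lie_smul, smul_lie, map_smul, LinearMap.smul_apply, smul_eq_mul,
      RingHom.id_apply]; ring

/-- The Levi-Civita connection of the nondegenerate form `g`: `∇_x y` is the vector that
represents `koszulForm g x y` with respect to `g`. -/
def leviCivita (g : LinearMap.BilinForm ℝ 𝔤) (hg : g.Nondegenerate) : 𝔤 →ₗ[ℝ] 𝔤 →ₗ[ℝ] 𝔤 :=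
  LinearMap.mk₂ ℝ (fun x y => (LinearMap.BilinForm.toDual g hg).symm (koszulForm g x y))
    (fun a b y => by
      rw [← map_add]; congr 1; ext z
      simp only [koszulForm, LinearMap.coe_mk, AddHom.coe_mk, LinearMap.add_apply, lie_add,
        add_lie, map_add]; ring)
    (fun c a y => by
      rw [← map_smul]; congr 1; ext z
      simp only [koszulForm, LinearMap.coe_mk, AddHom.coe_mk, LinearMap.smul_apply, lie_smul,
        smul_lie, map_smul, smul_eq_mul]; ring)
    (fun x a b => by
      rw [← map_add]; congr 1; ext z
      simp only [koszulForm, LinearMap.coe_mk, AddHom.coe_mk, LinearMap.add_apply, lie_add,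
        add_lie, map_add]; ring)
    (fun c x a => by
      rw [← map_smul]; congr 1; ext z
      simp only [koszulForm, LinearMap.coe_mk, AddHom.coe_mk, LinearMap.smul_apply, lie_smul,
        smul_lie, map_smul, smul_eq_mul]; ring)

/-- The Koszul formula. -/
theorem leviCivita_koszul (g : LinearMap.BilinForm ℝ 𝔤) (hg : g.Nondegenerate) (x y z : 𝔤) :
    2 * g (leviCivita g hg x y) z = g ⁅x, y⁆ z - g ⁅y, z⁆ x + g ⁅z, x⁆ y := by
  have h : g (leviCivita g hg x y) z = koszulForm g x y z :=
    LinearMap.BilinForm.apply_toDual_symm_apply (hB := hg) _ _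
  rw [h]
  simp only [koszulForm, LinearMap.coe_mk, AddHom.coe_mk]
  ring

/-- The curvature tensor `(x, y) ↦ R(x, y) = [∇_x, ∇_y] - ∇_{[x, y]}`. -/
def curvature (g : LinearMap.BilinForm ℝ 𝔤) (hg : g.Nondegenerate) (x y : 𝔤) :
    Module.End ℝ 𝔤 :=
  ⁅leviCivita g hg x, leviCivita g hg y⁆ - leviCivita g hg ⁅x, y⁆

/-- The linear map `v ↦ R(x, v) y`. -/
def curvatureMap (g : LinearMap.BilinForm ℝ 𝔤) (hg : g.Nondegenerate) (x y : 𝔤) :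
    𝔤 →ₗ[ℝ] 𝔤 where
  toFun v := curvature g hg x v y
  map_add' a b := by
    simp only [curvature, LinearMap.sub_apply, Ring.lie_def, Module.End.mul_apply, map_add,
      lie_add, LinearMap.add_apply]; abel
  map_smul' c a := by
    simp only [curvature, LinearMap.sub_apply, Ring.lie_def, Module.End.mul_apply, map_smul,
      lie_smul, LinearMap.smul_apply, RingHom.id_apply, smul_sub]

/-- The Ricci tensor `ric(x, y) = -tr (v ↦ R(x, v) y)`. -/
def ricci (g : LinearMap.BilinForm ℝ 𝔤) (hg : g.Nondegenerate) (x y : 𝔤) : ℝ :=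
  -LinearMap.trace ℝ 𝔤 (curvatureMap g hg x y)

/-- In an orthonormal frame, `ric(x, y) = -∑ᵢ εᵢ g(R(x, vᵢ) y, vᵢ)` with `εᵢ = g(vᵢ, vᵢ)`. -/
theorem ricci_eq_sum (g : LinearMap.BilinForm ℝ 𝔤) (hg : g.Nondegenerate)
    {ι : Type*} [Fintype ι] [DecidableEq ι] (v : Module.Basis ι ℝ 𝔤)
    (hv : ∀ i j, i ≠ j → g (v i) (v j) = 0) (hε : ∀ i, g (v i) (v i) = 1 ∨ g (v i) (v i) = -1)
    (x y : 𝔤) :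
    ricci g hg x y = -∑ i, g (v i) (v i) * g (curvature g hg x (v i) y) (v i) := by
  have key : ∀ w i, v.repr w i = g (v i) (v i) * g w (v i) := by
    intro w i
    have h1 : g w (v i) = v.repr w i * g (v i) (v i) := by
      conv_lhs => rw [← v.sum_repr w]
      simp only [map_sum, map_smul, LinearMap.sum_apply, LinearMap.smul_apply, smul_eq_mul]
      rw [Finset.sum_eq_single i]
      · intro j _ hj
        rw [hv j i hj, mul_zero]
      · simp
    rw [h1]
    rcases hε i with h | h <;> rw [h] <;> ring
  rw [ricci, LinearMap.trace_eq_matrix_trace ℝ v, Matrix.trace]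
  simp only [Matrix.diag_apply, LinearMap.toMatrix_apply, key]
  rfl

/-- The metric is flat: its curvature tensor vanishes. -/
def IsFlat (g : LinearMap.BilinForm ℝ 𝔤) (hg : g.Nondegenerate) : Prop :=
  ∀ x y, curvature g hg x y = 0

/-- The metric is Ricci flat: its Ricci tensor vanishes. -/
def IsRicciFlat (g : LinearMap.BilinForm ℝ 𝔤) (hg : g.Nondegenerate) : Prop :=
  ∀ x y, ricci g hg x y = 0

/-- The Levi-Civita connection is complete: for every initial value, the geodesic equation
`x'(t) = -∇_{x(t)} x(t)` in `𝔤` has a solution defined for all `t ∈ ℝ`. The derivative of the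
curve in the finite-dimensional space `𝔤` is taken componentwise, i.e. after applying an arbitrary
linear form. -/
def IsGeodesicallyComplete (g : LinearMap.BilinForm ℝ 𝔤) (hg : g.Nondegenerate) : Prop :=
  ∀ x₀ : 𝔤, ∃ x : ℝ → 𝔤, x 0 = x₀ ∧
    ∀ (φ : Module.Dual ℝ 𝔤) (t : ℝ),
      HasDerivAt (fun s => φ (x s)) (φ (-leviCivita g hg (x t) (x t))) t

end Geometry

/-! ### The two model algebras -/

/-- The Heisenberg Lie algebra `𝔥₃`: strictly upper triangular real `3 × 3` matrices. -/
def heisenberg3 : LieSubalgebra ℝ (Matrix (Fin 3) (Fin 3) ℝ) where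
  carrier := {A | ∀ i j, j ≤ i → A i j = 0}
  zero_mem' := fun _ _ _ => rfl
  add_mem' := fun {A B} hA hB i j h => by simp [hA i j h, hB i j h]
  smul_mem' := fun c A hA i j h => by simp [hA i j h]
  lie_mem' := fun {A B} hA hB i j h => by
    rw [Ring.lie_def, Matrix.sub_apply, Matrix.mul_apply, Matrix.mul_apply,
      Finset.sum_eq_zero, Finset.sum_eq_zero, sub_zero]
    all_goals
      intro k _
      rcases le_total k i with hk | hk
      · simp [hA i k hk, hB i k hk]
      · simp [hA k j (h.trans hk), hB k j (h.trans hk)]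

/-- The Lie algebra `𝔢(2)` of the group of rigid motions of `ℝ²`: real `3 × 3` matrices
`[[0, -θ, a], [θ, 0, b], [0, 0, 0]]`. -/
def euclidean2 : LieSubalgebra ℝ (Matrix (Fin 3) (Fin 3) ℝ) where
  carrier := {A | A 0 0 = 0 ∧ A 1 1 = 0 ∧ A 0 1 = -A 1 0 ∧ ∀ j, A 2 j = 0}
  zero_mem' := by simp
  add_mem' := by
    rintro A B ⟨h1, h2, h3, h4⟩ ⟨k1, k2, k3, k4⟩
    refine ⟨by simp [h1, k1], by simp [h2, k2], by simp [h3, k3]; ring, fun j => by simp [h4, k4]⟩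
  smul_mem' := by
    rintro c A ⟨h1, h2, h3, h4⟩
    refine ⟨by simp [h1], by simp [h2], by simp [h3], fun j => by simp [h4]⟩
  lie_mem' := by
    rintro A B ⟨h1, h2, h3, h4⟩ ⟨k1, k2, k3, k4⟩
    refine ⟨?_, ?_, ?_, fun j => ?_⟩ <;>
      simp [Ring.lie_def, Matrix.mul_apply, Fin.sum_univ_three, h1, h2, h3, h4, k1, k2, k3, k4] <;>
      ring

end PseudoKahler

end

/-!
The complex structure `J` is parallel for the Levi-Civita connection `∇` of a pseudo-Kähler metric,
so `∇ x y` is complex linear in `y`, and it splits into a part linear and a part antilinear in `x`.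
The Bianchi identity says that the linear part is a left-symmetric product and that the mixed part
of the curvature is symmetric. Skewness of `∇ x` and unimodularity make all right multiplications
traceless. In complex dimension two this forces `∇` to have rank one: `∇ x y = l x • M y`, where
`M = g(e, ·) Je - g(Je, ·) e` and `l` vanishes on the range of `M`. Hence `∇` is flat, `l` is
constant along a geodesic, which thus solves a linear equation with constant coefficients, and the
bracket `⁅x, y⁆ = l x • M y - l y • M x` depends, up to isomorphism, only on whether it vanishes and
on whether `g(e, e)` does.
-/

noncomputable section

namespace PseudoKahler

open ComplexConjugate

section Plane

variable {K V W : Type*} [Field K] [AddCommGroup V] [Module K V] [AddCommGroup W] [Module K W]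

theorem exists_eq_smul_of_apply_eq_zero (hV : Module.finrank K V = 2) {T : V →ₗ[K] W}
    (hT : T ≠ 0) {e f : V} (he : e ≠ 0) (hTe : T e = 0) (hTf : T f = 0) : ∃ c : K, f = c • e := by
  by_contra! hef
  have hli : LinearIndependent K ![e, f] :=
    (LinearIndependent.pair_iff' he).2 fun c hc => hef c hc.symm
  let b := basisOfLinearIndependentOfCardEqFinrank hli (by simp [hV])
  refine hT (b.ext fun i => ?_)
  fin_cases i <;> simp [b, hTe, hTf]

theorem mul_self_eq_zero_of_trace_eq_zero (h2 : (2 : K) ≠ 0) (hV : Module.finrank K V = 2)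
    {N : Module.End K V} (hN : LinearMap.trace K V N = 0) (hNN : LinearMap.trace K V (N * N) = 0) :
    N * N = 0 := by
  have : FiniteDimensional K V := Module.finite_of_finrank_eq_succ hV
  let b := Module.finBasisOfFinrankEq K V hV
  rw [LinearMap.trace_eq_matrix_trace K b] at hN hNN
  rw [LinearMap.toMatrix_mul] at hNN
  rw [← (LinearMap.toMatrix b b).map_eq_zero_iff, LinearMap.toMatrix_mul]
  generalize LinearMap.toMatrix b b N = M at hN hNN
  have hch : M * M = -M.det • (1 : Matrix (Fin 2) (Fin 2) K) := by
    rw [← sub_eq_zero, ← M.aeval_self_charpoly, Matrix.charpoly_fin_two]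
    simp [hN, sq, Algebra.algebraMap_eq_smul_one]
  have hdet : M.det = 0 := by
    rw [hch, Matrix.trace_smul, Matrix.trace_one] at hNN
    simpa [h2] using hNN
  rw [hch, hdet, neg_zero, zero_smul]

theorem exists_eq_smul_of_mul_self_eq_zero (hV : Module.finrank K V = 2)
    {M N : Module.End K V} (hN0 : N ≠ 0) (hNN : N * N = 0) (hMM : M * M = 0)
    (hNM : N * M + M * N = 0) : ∃ c : K, M = c • N := by
  obtain ⟨v, hv⟩ := DFunLike.ne_iff.1 hN0
  have hNN' (x : V) : N (N x) = 0 := LinearMap.congr_fun hNN x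
  have hMM' (x : V) : M (M x) = 0 := LinearMap.congr_fun hMM x
  have hNM' (x : V) : N (M x) + M (N x) = 0 := LinearMap.congr_fun hNM x
  have hMN : M (N v) = 0 := by
    obtain ⟨a, ha⟩ : ∃ a : K, M (N v) = a • N v :=
      exists_eq_smul_of_apply_eq_zero hV hN0 hv (hNN' v) (by simpa [hNN'] using hNM' (N v))
    have haa : (a * a) • N v = 0 := by rw [mul_smul, ← ha, ← map_smul, ← ha, hMM']
    have ha0 : a = 0 := by simpa using (smul_eq_zero.1 haa).resolve_right hv
    rw [ha, ha0, zero_smul]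
  obtain ⟨c, hc⟩ : ∃ c : K, M v = c • N v :=
    exists_eq_smul_of_apply_eq_zero hV hN0 hv (hNN' v) (by simpa [hMN] using hNM' v)
  refine ⟨c, ?_⟩
  by_contra hMc
  obtain ⟨d, hd⟩ : ∃ d : K, v = d • N v :=
    exists_eq_smul_of_apply_eq_zero hV (sub_ne_zero.2 hMc) hv (by simp [hMN, hNN']) (by simp [hc])
  exact hv (by rw [hd, map_smul, hNN', smul_zero]; rfl)

theorem exists_eq_smul_of_trace_eq_zero (h2 : (2 : K) ≠ 0) (hV : Module.finrank K V = 2)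
    {M N : Module.End K V} (hN0 : N ≠ 0) (hN : LinearMap.trace K V N = 0)
    (hM : LinearMap.trace K V M = 0) (hNN : LinearMap.trace K V (N * N) = 0)
    (hNM : LinearMap.trace K V (N * M) = 0) (hMM : LinearMap.trace K V (M * M) = 0) :
    ∃ c : K, M = c • N := by
  have hNN' := mul_self_eq_zero_of_trace_eq_zero h2 hV hN hNN
  have hMM' := mul_self_eq_zero_of_trace_eq_zero h2 hV hM hMM
  refine exists_eq_smul_of_mul_self_eq_zero hV hN0 hNN' hMM' ?_
  have hsq := mul_self_eq_zero_of_trace_eq_zero h2 hV (N := N + M) (by simp [hN, hM])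
    (by simp [mul_add, add_mul, hNN, hNM, hMM, LinearMap.trace_mul_comm K M N])
  simpa [mul_add, add_mul, hNN', hMM', add_comm] using hsq

theorem exists_apply_eq_smul_of_mul_self_eq_zero (hV : Module.finrank K V = 2)
    {N : Module.End K V} (hNN : N * N = 0) :
    ∃ (ν : Module.Dual K V) (e : V), ν e = 0 ∧ ∀ x, N x = ν x • e := by
  by_cases hN0 : N = 0
  · exact ⟨0, 0, rfl, fun x => by simp [hN0]⟩
  obtain ⟨v, hv⟩ := DFunLike.ne_iff.1 hN0
  have hNN' (x : V) : N (N x) = 0 := LinearMap.congr_fun hNN x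
  obtain ⟨ψ, hψ⟩ := Module.Projective.exists_dual_eq_one K hv
  refine ⟨ψ ∘ₗ N, N v, by simp [hNN'], fun x => ?_⟩
  obtain ⟨c, hc⟩ : ∃ c : K, N x = c • N v :=
    exists_eq_smul_of_apply_eq_zero hV hN0 hv (hNN' v) (hNN' x)
  simp [hc, hψ]

end Plane

section LeftSymmetric

/-- The curvature `⁅D x, D y⁆ - D (D x y - D y x)` of a product `D` on a module, regarded as a
torsion-free connection. The product is left-symmetric when this vanishes. The multiplications
may be linear over a larger ring `S` than `D`. -/
def productCurvature {R S V : Type*} [CommRing R] [CommRing S] [AddCommGroup V]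
    [Module R V] [Module S V] [SMulCommClass S R V] (D : V →ₗ[R] Module.End S V) (x y : V) :
    Module.End S V :=
  ⁅D x, D y⁆ - D (D x y - D y x)

theorem trace_flip_mul_flip_eq_zero {R V : Type*} [CommRing R] [AddCommGroup V] [Module R V]
    {A : V →ₗ[R] V →ₗ[R] V} (hA : ∀ x y, productCurvature A x y = 0)
    (htr : ∀ x, LinearMap.trace R V (A.flip x) = 0) (x y : V) :
    LinearMap.trace R V (A.flip x * A.flip y) = 0 := by
  have hxy : A.flip x * A.flip y = A.flip x * A y - A y * A.flip x + A.flip (A y x) := by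
    ext z
    have := LinearMap.congr_fun (hA z y) x
    simp only [productCurvature, Ring.lie_def, LinearMap.sub_apply, Module.End.mul_apply,
      map_sub, LinearMap.zero_apply] at this
    simp only [Module.End.mul_apply, LinearMap.flip_apply, LinearMap.add_apply, LinearMap.sub_apply]
    linear_combination (norm := module) -this
  rw [hxy, map_add, map_sub, LinearMap.trace_mul_comm, sub_self, htr, add_zero]

variable {K V : Type*} [Field K] [AddCommGroup V] [Module K V]

theorem exists_eq_smul_of_leftSymmetric (h2 : (2 : K) ≠ 0) (hV : Module.finrank K V = 2)
    {A : V →ₗ[K] V →ₗ[K] V} (hA : ∀ x y, productCurvature A x y = 0)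
    (htr : ∀ x, LinearMap.trace K V (A.flip x) = 0) :
    ∃ (e : V) (ν φ : Module.Dual K V), ν e = 0 ∧ ∀ x y, A x y = (ν x * φ y) • e := by
  have htr₂ := trace_flip_mul_flip_eq_zero hA htr
  by_cases hA0 : A.flip = 0
  · exact ⟨0, 0, 0, rfl, fun x y => by simp [← A.flip_apply, hA0]⟩
  obtain ⟨y₀, hy₀⟩ := DFunLike.ne_iff.1 hA0
  have hsmul (y : V) : ∃ c : K, A.flip y = c • A.flip y₀ :=
    exists_eq_smul_of_trace_eq_zero h2 hV hy₀ (htr y₀) (htr y) (htr₂ y₀ y₀) (htr₂ y₀ y)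
      (htr₂ y y)
  obtain ⟨ν, e, hνe, hν⟩ := exists_apply_eq_smul_of_mul_self_eq_zero hV
    (mul_self_eq_zero_of_trace_eq_zero h2 hV (htr y₀) (htr₂ y₀ y₀))
  obtain ⟨x₀, hx₀⟩ := DFunLike.ne_iff.1 hy₀
  obtain ⟨ψ, hψ⟩ := Module.Projective.exists_dual_eq_one K hx₀
  refine ⟨e, ν, ψ ∘ₗ A x₀, hνe, fun x y => ?_⟩
  obtain ⟨c, hc⟩ := hsmul y
  have hy (x : V) : A x y = c • A.flip y₀ x := LinearMap.congr_fun hc x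
  have hψy : ψ (A x₀ y) = c := by rw [hy, map_smul, hψ, smul_eq_mul, mul_one]
  rw [LinearMap.comp_apply, hψy, hy, hν, smul_smul, mul_comm]

end LeftSymmetric

section Hermitian

variable {K V : Type*} [Field K] [AddCommGroup V] [Module K V]

theorem surjective_of_separatingRight [FiniteDimensional K V] {σ : K →+* K} [RingHomSurjective σ]
    {h : V →ₛₗ[σ] V →ₗ[K] K} (hr : h.SeparatingRight) : Function.Surjective h := by
  let W : Subspace K (Module.Dual K V) := LinearMap.range h
  have hW : W.dualCoannihilator = ⊥ := by
    rw [eq_bot_iff]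
    intro y hy
    exact hr y fun x => (Submodule.mem_dualCoannihilator y).1 hy _ ⟨x, rfl⟩
  rw [← LinearMap.range_eq_top]
  change W = ⊤
  rw [← Subspace.dualCoannihilator_dualAnnihilator_eq (W := W), hW, Submodule.dualAnnihilator_bot]

variable [StarRing K]

/-- For a connection `D = A + B` on `V` with `A` linear and `B` conjugate-linear in the first
argument, the component of `productCurvature D x y` that is linear in `x` and conjugate-linear
in `y`. -/
def mixedCurvature (A : V →ₗ[K] Module.End K V) (B : V →ₗ⋆[K] Module.End K V) (x y : V) :
    Module.End K V :=
  ⁅A x, B y⁆ + A (B y x) - B (B x y)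

variable {h : V →ₗ⋆[K] V →ₗ[K] K} {A : V →ₗ[K] Module.End K V} {B : V →ₗ⋆[K] Module.End K V}
  {e f n : V}

theorem adjoint_apply_eq_smul (hs : h.IsSymm) (hr : h.SeparatingRight)
    (hAB : ∀ x y z, h (A x y) z = -h y (B x z))
    (hA : ∀ x y, A x y = (h n x * h f y) • e) (x z : V) : B x z = -(h x n * h e z) • f := by
  rw [← sub_eq_zero]
  refine hr _ fun y => ?_
  have hyz := hAB x y z
  simp only [hA, map_smulₛₗ, map_mul, LinearMap.smul_apply, smul_eq_mul, hs.eq] at hyz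
  simp only [map_sub, map_smul, smul_eq_mul]
  linear_combination hyz

theorem smul_add_smul_eq_zero_of_mixedCurvature_comm (hs : h.IsSymm)
    (hA : ∀ x y, A x y = (h n x * h f y) • e) (hB : ∀ x z, B x z = -(h x n * h e z) • f)
    (hAB : ∀ x y z, mixedCurvature A B x y z = mixedCurvature A B z y x) (x y z : V) :
    (h y n * (h f f * (h n x * h e z - h n z * h e x) +
        h n f * (h e x * h f z - h e z * h f x))) • e +
      (h f n * h y e * (h n x * h e z - h n z * h e x) -
        h y n * h e e * (h n x * h f z - h n z * h f x)) • f = 0 := by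
  have hxyz := hAB x y z
  simp only [mixedCurvature, Ring.lie_def, LinearMap.add_apply, LinearMap.sub_apply,
    Module.End.mul_apply, hA, hB, map_smulₛₗ, map_neg, map_mul, hs.eq, RingHom.id_apply,
    LinearMap.smul_apply, smul_eq_mul] at hxyz
  linear_combination (norm := module) -hxyz

theorem exists_eq_smul_of_mixedCurvature_comm (hV : Module.finrank K V = 2) (hs : h.IsSymm)
    (hl : h.SeparatingLeft) (he0 : e ≠ 0) (hn0 : n ≠ 0) (hne : h n e = 0)
    (hA : ∀ x y, A x y = (h n x * h f y) • e) (hB : ∀ x z, B x z = -(h x n * h e z) • f)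
    (hAB : ∀ x y z, mixedCurvature A B x y z = mixedCurvature A B z y x) :
    ∃ c : K, f = c • e := by
  have hen : h e n = 0 := hs.isRefl _ _ hne
  have hnot {v : V} (hv : v ≠ 0) : h v ≠ 0 := fun h0 => hv (hl v fun y => by simp [h0])
  by_contra hef
  have hli : LinearIndependent K ![e, f] :=
    (LinearIndependent.pair_iff' he0).2 fun c hc => hef ⟨c, hc.symm⟩
  have hcoeff (x y z : V) := LinearIndependent.pair_iff.1 hli _ _
    (smul_add_smul_eq_zero_of_mixedCurvature_comm hs hA hB hAB x y z)
  obtain ⟨z, hz⟩ := DFunLike.ne_iff.1 (hnot hn0)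
  rw [LinearMap.zero_apply] at hz
  suffices hnf : h n f = 0 from
    hef (exists_eq_smul_of_apply_eq_zero hV (hnot hn0) he0 hne hnf)
  by_cases hee : h e e = 0
  · obtain ⟨c, rfl⟩ : ∃ c : K, n = c • e :=
      exists_eq_smul_of_apply_eq_zero hV (hnot he0) he0 hee hen
    have hzn : h z (c • e) ≠ 0 := fun h0 => hz (hs.isRefl _ _ h0)
    have hez := (hcoeff z z e).1
    simp only [map_smulₛₗ, LinearMap.smul_apply, smul_eq_mul, hee] at hez hz hzn ⊢
    have hfe : h e f * h f e = 0 := by grind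
    rcases mul_eq_zero.1 hfe with h0 | h0
    · simp [h0]
    · simp [hs.isRefl _ _ h0]
  · refine hs.isRefl _ _ ?_
    simpa [hne, hen, hee, hz] using (hcoeff e e z).2

theorem exists_hermitian_rank_one (h2 : (2 : K) ≠ 0) (hV : Module.finrank K V = 2)
    (hs : h.IsSymm) (hnd : h.Nondegenerate) (hadj : ∀ x y z, h (A x y) z = -h y (B x z))
    (hA : ∀ x y, productCurvature A x y = 0)
    (htr : ∀ x, LinearMap.trace K V (LinearMap.flip A x) = 0)
    (hAB : ∀ x y z, mixedCurvature A B x y z = mixedCurvature A B z y x) :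
    ∃ (e : V) (μ : Module.Dual K V), μ e = 0 ∧ (∀ x y, A x y = (μ x * h e y) • e) ∧
      ∀ x y, B x y = -(conj (μ x) * h e y) • e := by
  have : FiniteDimensional K V := Module.finite_of_finrank_eq_succ hV
  obtain ⟨e, ν, φ, hνe, hA⟩ := exists_eq_smul_of_leftSymmetric h2 hV hA htr
  obtain ⟨n, rfl⟩ := surjective_of_separatingRight hnd.2 ν
  obtain ⟨f, rfl⟩ := surjective_of_separatingRight hnd.2 φ
  have hB := adjoint_apply_eq_smul hs hnd.2 hadj hA
  by_cases he0 : e = 0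
  · exact ⟨0, 0, by simp, by simp [hA, he0], by simp [hB, he0]⟩
  by_cases hn0 : n = 0
  · exact ⟨0, 0, by simp, by simp [hA, hn0], by simp [hB, hn0]⟩
  obtain ⟨c, rfl⟩ := exists_eq_smul_of_mixedCurvature_comm hV hs hnd.1 he0 hn0 hνe hA hB hAB
  refine ⟨e, conj c • h n, by simp [hνe], fun x y => ?_, fun x y => ?_⟩
  · simp [hA, mul_left_comm, mul_assoc]
  · simp [hB, hs.eq, smul_smul, mul_comm, mul_left_comm]

end Hermitian

section ComplexParts

open Complex

variable {V E : Type*} [AddCommGroup V] [Module ℂ V] [AddCommGroup E] [Module ℂ E]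

theorem I_smul_I_smul (v : V) : I • I • v = -v := by
  rw [smul_smul, I_mul_I, neg_one_smul]

variable [Module ℝ V] [IsScalarTower ℝ ℂ V]

theorem smul_eq_re_smul_add_im_smul (c : ℂ) (v : V) : c • v = c.re • v + c.im • I • v := by
  rw [← algebraMap_smul ℂ c.re, ← algebraMap_smul ℂ c.im, smul_smul, ← add_smul, coe_algebraMap,
    re_add_im]

theorem map_smul_eq_re_smul_add_im_smul {E : Type*} [AddCommGroup E] [Module ℝ E]
    (f : V →ₗ[ℝ] E) (c : ℂ) (x : V) :
    f (c • x) = c.re • f x + c.im • f (I • x) := by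
  rw [smul_eq_re_smul_add_im_smul, map_add, map_smul, map_smul]

variable [Module ℝ E] [IsScalarTower ℝ ℂ E]

/-- The complex-linear part of a real-linear map between complex vector spaces. -/
def complexLinearPart (f : V →ₗ[ℝ] E) : V →ₗ[ℂ] E where
  toFun x := (1 / 2 : ℂ) • (f x - I • f (I • x))
  map_add' x y := by simp only [smul_add, map_add]; module
  map_smul' c x := by
    rw [RingHom.id_apply, smul_eq_re_smul_add_im_smul c (_ : E), smul_comm I c,
      map_smul_eq_re_smul_add_im_smul f c x, map_smul_eq_re_smul_add_im_smul f c (I • x)]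
    simp only [I_smul_I_smul, map_neg, smul_comm I (1 / 2 : ℂ), smul_sub, smul_add, smul_neg,
      smul_comm I (_ : ℝ)]
    module

/-- The complex-antilinear part of a real-linear map between complex vector spaces. -/
def complexAntilinearPart (f : V →ₗ[ℝ] E) : V →ₗ⋆[ℂ] E where
  toFun x := (1 / 2 : ℂ) • (f x + I • f (I • x))
  map_add' x y := by simp only [smul_add, map_add]; module
  map_smul' c x := by
    rw [smul_eq_re_smul_add_im_smul (conj c) (_ : E), smul_comm I c,
      map_smul_eq_re_smul_add_im_smul f c x, map_smul_eq_re_smul_add_im_smul f c (I • x)]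
    simp only [I_smul_I_smul, map_neg, smul_comm I (1 / 2 : ℂ), smul_add, smul_neg,
      smul_comm I (_ : ℝ), conj_re, conj_im]
    module

theorem complexLinearPart_apply (f : V →ₗ[ℝ] E) (x : V) :
    complexLinearPart f x = (1 / 2 : ℂ) • (f x - I • f (I • x)) := rfl

theorem complexAntilinearPart_apply (f : V →ₗ[ℝ] E) (x : V) :
    complexAntilinearPart f x = (1 / 2 : ℂ) • (f x + I • f (I • x)) := rfl

theorem complexLinearPart_add_complexAntilinearPart (f : V →ₗ[ℝ] E) (x : V) :
    complexLinearPart f x + complexAntilinearPart f x = f x := by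
  rw [complexLinearPart_apply, complexAntilinearPart_apply]
  module

theorem trace_restrictScalars [FiniteDimensional ℂ V] (f : V →ₗ[ℂ] V) :
    LinearMap.trace ℝ V (f.restrictScalars ℝ) = 2 * (LinearMap.trace ℂ V f).re := by
  let b := Module.finBasis ℂ V
  simp only [LinearMap.trace_eq_matrix_trace ℝ (basisOneI.smulTower b),
    LinearMap.trace_eq_matrix_trace ℂ b, Matrix.trace, Fintype.sum_prod_type, Fin.sum_univ_two,
    Matrix.diag_apply, LinearMap.toMatrix_apply, Module.Basis.smulTower_repr,
    Module.Basis.smulTower_apply, LinearMap.restrictScalars_apply, map_smul, Finsupp.smul_apply]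
  simp [coe_basisOneI, coe_basisOneI_repr, two_mul]

theorem trace_eq_zero_of_antilinear {f : Module.End ℝ V} (hf : ∀ x, f (I • x) = -(I • f x)) :
    LinearMap.trace ℝ V f = 0 := by
  let J : Module.End ℝ V := Module.toModuleEnd ℝ V I
  have hJJ : J * J = -1 := LinearMap.ext fun x => I_smul_I_smul x
  have hJfJ : J * f * J = f := LinearMap.ext fun x => by
    change I • f (I • x) = f x
    rw [hf, smul_neg, I_smul_I_smul, neg_neg]
  have htr : LinearMap.trace ℝ V f = -LinearMap.trace ℝ V f := by
    nth_rw 1 [← hJfJ]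
    rw [LinearMap.trace_mul_comm, ← mul_assoc, hJJ, neg_one_mul, map_neg]
  exact self_eq_neg.1 htr

section Connection

variable {D : V →ₗ[ℝ] Module.End ℂ V} {A : V →ₗ[ℂ] Module.End ℂ V} {B : V →ₗ⋆[ℂ] Module.End ℂ V}

theorem mixedCurvature_sub_add_eq_zero_of_bianchi (hD : ∀ x, D x = A x + B x)
    (hbianchi : ∀ x y z, productCurvature D x y z + productCurvature D y z x +
      productCurvature D z x y = 0) (x y z : V) :
    mixedCurvature A B x y z - mixedCurvature A B z y x +
      (⁅B z, B x⁆ - B (A z x - A x z)) y = 0 := by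
  have h₀ := hbianchi x y z
  have h₁ := hbianchi (I • x) (I • y) z
  have h₂ := hbianchi x (I • y) (I • z)
  have h₃ := hbianchi (I • x) y (I • z)
  simp only [productCurvature, mixedCurvature, Ring.lie_def, hD, LinearMap.sub_apply,
    LinearMap.add_apply, Module.End.mul_apply, map_add, map_sub, map_smul, map_smulₛₗ,
    LinearMap.smul_apply, conj_I, neg_smul, smul_neg, map_neg, LinearMap.neg_apply, I_smul_I_smul,
    smul_add, smul_sub] at h₀ h₁ h₂ h₃ ⊢
  -- This combination keeps the components of the Bianchi sum whose type in `y`, linear or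
  -- antilinear, is opposite to their types in `x` and in `z`.
  linear_combination (norm := module) (1 / 4 : ℂ) • (h₀ + h₁ + h₂ - h₃)

theorem mixedCurvature_comm_of_bianchi (hD : ∀ x, D x = A x + B x)
    (hbianchi : ∀ x y z, productCurvature D x y z + productCurvature D y z x +
      productCurvature D z x y = 0) (x y z : V) :
    mixedCurvature A B x y z = mixedCurvature A B z y x := by
  have h₀ := mixedCurvature_sub_add_eq_zero_of_bianchi hD hbianchi x y z
  have h₁ := mixedCurvature_sub_add_eq_zero_of_bianchi hD hbianchi (I • x) y z
  simp only [mixedCurvature, Ring.lie_def, LinearMap.sub_apply, LinearMap.add_apply,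
    Module.End.mul_apply, map_sub, map_smul, map_smulₛₗ, LinearMap.smul_apply, conj_I, map_neg,
    LinearMap.neg_apply, neg_smul] at h₀ h₁ ⊢
  -- The mixed curvatures are linear in `x`, the remaining term of `h₀` is antilinear.
  linear_combination (norm := skip) (1 / 2 : ℂ) • (h₀ - I • h₁)
  simp only [smul_sub, smul_add, smul_neg, I_smul_I_smul]
  module

theorem lie_eq_of_bianchi (hD : ∀ x, D x = A x + B x)
    (hbianchi : ∀ x y z, productCurvature D x y z + productCurvature D y z x +
      productCurvature D z x y = 0) (x y : V) : ⁅B x, B y⁆ = B (A x y - A y x) := by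
  ext z
  have h₀ := mixedCurvature_sub_add_eq_zero_of_bianchi hD hbianchi y z x
  rw [mixedCurvature_comm_of_bianchi hD hbianchi y z x, sub_self, zero_add] at h₀
  exact sub_eq_zero.1 h₀

theorem leftSymmetric_of_bianchi {h : V →ₗ⋆[ℂ] V →ₗ[ℂ] ℂ} (hl : h.SeparatingLeft)
    (hadj : ∀ x y z, h (A x y) z = -h y (B x z)) (hD : ∀ x, D x = A x + B x)
    (hbianchi : ∀ x y z, productCurvature D x y z + productCurvature D y z x +
      productCurvature D z x y = 0) (x y : V) : productCurvature A x y = 0 := by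
  ext u
  refine hl _ fun z => ?_
  have hB := congr(h u ($(lie_eq_of_bianchi hD hbianchi x y) z))
  simp only [productCurvature, Ring.lie_def, LinearMap.sub_apply, Module.End.mul_apply, map_sub,
    hadj] at hB ⊢
  linear_combination -hB

theorem adjoint_complexLinearPart {h : V →ₗ⋆[ℂ] V →ₗ[ℂ] ℂ}
    (hD : ∀ x y z, h (D x y) z = -h y (D x z)) (x y z : V) :
    h (complexLinearPart D x y) z = -h y (complexAntilinearPart D x z) := by
  simp only [complexLinearPart_apply, complexAntilinearPart_apply, LinearMap.smul_apply,
    LinearMap.sub_apply, LinearMap.add_apply, map_smulₛₗ, map_sub, map_add, hD, smul_eq_mul,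
    RingHom.id_apply, conj_I, map_div₀, map_one, map_ofNat]
  ring

theorem trace_flip_complexLinearPart_eq_zero [FiniteDimensional ℂ V]
    (htr : ∀ x, LinearMap.trace ℝ V (D.flip x) = 0) (x : V) :
    LinearMap.trace ℂ V (LinearMap.flip (complexLinearPart D) x) = 0 := by
  have hre (x : V) : (LinearMap.trace ℂ V (LinearMap.flip (complexLinearPart D) x)).re = 0 := by
    let A : Module.End ℝ V := (LinearMap.flip (complexLinearPart D) x).restrictScalars ℝ
    have hanti : LinearMap.trace ℝ V (D.flip x - A) = 0 := by
      refine trace_eq_zero_of_antilinear fun y => ?_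
      have (y : V) : (D.flip x - A) y = complexAntilinearPart D y x := by
        simp [A, sub_eq_iff_eq_add', ← LinearMap.add_apply,
          complexLinearPart_add_complexAntilinearPart]
      simp [this]
    have hA := trace_restrictScalars (LinearMap.flip (complexLinearPart D) x)
    rw [map_sub, htr, zero_sub, neg_eq_zero] at hanti
    linarith
  refine Complex.ext (hre x) ?_
  have := hre (I • x)
  simpa using this

theorem exists_rank_one_of_bianchi (hV : Module.finrank ℂ V = 2) {h : V →ₗ⋆[ℂ] V →ₗ[ℂ] ℂ}
    (hs : h.IsSymm) (hnd : h.Nondegenerate) (hD : ∀ x y z, h (D x y) z = -h y (D x z))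
    (hbianchi : ∀ x y z, productCurvature D x y z + productCurvature D y z x +
      productCurvature D z x y = 0)
    (htr : ∀ x, LinearMap.trace ℝ V (D.flip x) = 0) :
    ∃ (e : V) (l : Module.Dual ℝ V), l e = 0 ∧ l (I • e) = 0 ∧
      ∀ x y, D x y = l x • (I * h e y) • e := by
  have : FiniteDimensional ℂ V := Module.finite_of_finrank_eq_succ hV
  have hsum (x : V) := (complexLinearPart_add_complexAntilinearPart D x).symm
  have hadj := adjoint_complexLinearPart hD
  obtain ⟨e, μ, hμe, hA, hB⟩ := exists_hermitian_rank_one two_ne_zero hV hs hnd hadj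
    (leftSymmetric_of_bianchi hnd.1 hadj hsum hbianchi)
    (trace_flip_complexLinearPart_eq_zero htr) (mixedCurvature_comm_of_bianchi hsum hbianchi)
  refine ⟨e, (2 : ℝ) • imLm ∘ₗ μ.restrictScalars ℝ, by simp [hμe], by simp [hμe], fun x y => ?_⟩
  have him := sub_conj (μ x)
  rw [hsum, LinearMap.add_apply, hA, hB, ← add_smul, ← algebraMap_smul ℂ (_ : ℝ),
    smul_smul]
  congr 1
  simp only [coe_algebraMap, LinearMap.smul_apply, LinearMap.comp_apply,
    LinearMap.restrictScalars_apply, imLm_coe, smul_eq_mul]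
  linear_combination h e y * him

end Connection

end ComplexParts

section HermitianForm

open Complex

variable {V : Type*} [AddCommGroup V] [Module ℂ V] [Module ℝ V] [IsScalarTower ℝ ℂ V]
  {g : LinearMap.BilinForm ℝ V} {hI : ∀ x y, g (I • x) y = -g x (I • y)}

/-- The sesquilinear form `g(x, y) - i g(x, iy)` whose real part is a bilinear form `g` for which
multiplication by `i` is skew. -/
def hermitianForm (g : LinearMap.BilinForm ℝ V) (hI : ∀ x y, g (I • x) y = -g x (I • y)) :
    V →ₗ⋆[ℂ] V →ₗ[ℂ] ℂ where
  toFun x := Module.Dual.extendRCLike (𝕜 := ℂ) (g x)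
  map_add' x y := by ext; simp [Module.Dual.extendRCLike_apply]; ring
  map_smul' c x := by
    ext y
    rw [map_smul_eq_re_smul_add_im_smul g c x]
    refine Complex.ext ?_ ?_ <;>
      simp [Module.Dual.extendRCLike_apply, hI, I_smul_I_smul] <;>
      ring

theorem hermitianForm_apply (x y : V) : hermitianForm g hI x y = g x y - I * g x (I • y) := rfl

theorem hermitianForm_isSymm (hs : ∀ x y, g x y = g y x) : (hermitianForm g hI).IsSymm :=
  ⟨fun x y => by
    rw [hermitianForm_apply, hermitianForm_apply, hs y x, hs y (I • x), hI x y]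
    simp⟩

theorem hermitianForm_nondegenerate (hg : g.Nondegenerate) :
    (hermitianForm g hI).Nondegenerate := by
  have hre (x y : V) (h : hermitianForm g hI x y = 0) : g x y = 0 := by
    simpa [hermitianForm_apply] using congr(($h).re)
  exact ⟨fun x hx => hg.1 x fun y => hre x y (hx y), fun y hy => hg.2 y fun x => hre x y (hy x)⟩

theorem hermitianForm_skew {T : Module.End ℂ V} (hT : ∀ y z, g (T y) z = -g y (T z)) (y z : V) :
    hermitianForm g hI (T y) z = -hermitianForm g hI y (T z) := by
  simp only [hermitianForm_apply, hT, map_smul]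
  push_cast
  ring

end HermitianForm

section SkewTrace

variable {K E : Type*} [Field K] [AddCommGroup E] [Module K E] [FiniteDimensional K E]
  {g : LinearMap.BilinForm K E}

theorem trace_eq_trace_of_adjoint (hg : g.Nondegenerate) {S T : Module.End K E}
    (hT : ∀ y z, g (S y) z = g y (T z)) : LinearMap.trace K E S = LinearMap.trace K E T := by
  have hconj : (LinearMap.BilinForm.toDual g hg).conj S = Module.Dual.transpose (R := K) T := by
    ext φ z
    obtain ⟨y, rfl⟩ := (LinearMap.BilinForm.toDual g hg).surjective φ
    rw [LinearEquiv.conj_apply_apply, LinearEquiv.symm_apply_apply]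
    exact hT y z
  rw [← LinearMap.trace_conj' S (LinearMap.BilinForm.toDual g hg), hconj,
    LinearMap.trace_transpose']

theorem trace_eq_zero_of_skew [CharZero K] (hg : g.Nondegenerate) {T : Module.End K E}
    (hT : ∀ y z, g (T y) z = -g y (T z)) : LinearMap.trace K E T = 0 := by
  have hneg := trace_eq_trace_of_adjoint hg (S := T) (T := -T) fun y z => by
    rw [hT, LinearMap.neg_apply, map_neg]
  rw [map_neg] at hneg
  exact self_eq_neg.1 hneg

end SkewTrace

section KahlerGeometry

variable {𝔤 : Type*} [LieRing 𝔤] [LieAlgebra ℝ 𝔤] {J : 𝔤 →ₗ[ℝ] 𝔤}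
  {ω g : LinearMap.BilinForm ℝ 𝔤}

theorem IsKahlerStructure.apply_J_left (h : IsKahlerStructure J ω) (u v : 𝔤) :
    ω (J u) v = -ω u (J v) := by
  rw [← h.compatible u (J v), h.complex.sq, map_neg, neg_neg]

theorem IsKahlerStructure.metric_J_left (h : IsKahlerStructure J ω)
    (hgω : ∀ x y, g x y = ω (J x) y) (x y : 𝔤) : g (J x) y = -g x (J y) := by
  rw [hgω, hgω, h.apply_J_left]

variable [FiniteDimensional ℝ 𝔤]

theorem leviCivita_skew (hg : g.Nondegenerate) (hs : ∀ x y, g x y = g y x) (x y z : 𝔤) :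
    g (leviCivita g hg x y) z = -g y (leviCivita g hg x z) := by
  have hy := leviCivita_koszul g hg x y z
  have hz := leviCivita_koszul g hg x z y
  rw [hs y (leviCivita g hg x z)]
  rw [← lie_skew z x] at hy
  rw [← lie_skew z y, ← lie_skew y x] at hz
  simp only [map_neg, LinearMap.neg_apply] at hy hz
  linarith

theorem leviCivita_sub_leviCivita (hg : g.Nondegenerate) (x y : 𝔤) :
    leviCivita g hg x y - leviCivita g hg y x = ⁅x, y⁆ := by
  rw [← sub_eq_zero]
  refine hg.1 _ fun z => ?_
  have hx := leviCivita_koszul g hg x y z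
  have hy := leviCivita_koszul g hg y x z
  rw [← lie_skew z x] at hx
  rw [← lie_skew z y, ← lie_skew y x] at hy
  simp only [map_neg, LinearMap.neg_apply, map_sub, LinearMap.sub_apply] at hx hy ⊢
  linarith

theorem IsKahlerStructure.leviCivita_J (h : IsKahlerStructure J ω)
    (hgω : ∀ x y, g x y = ω (J x) y) (hg : g.Nondegenerate) (x y : 𝔤) :
    leviCivita g hg x (J y) = J (leviCivita g hg x y) := by
  rw [← sub_eq_zero]
  refine hg.1 _ fun z => ?_
  have hkoszul₁ := leviCivita_koszul g hg x (J y) z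
  have hkoszul₂ := leviCivita_koszul g hg x y (J z)
  have hclosed₁ := h.symplectic.closed x y z
  have hclosed₂ := h.symplectic.closed x (J y) (J z)
  have hnijenhuis := congr(ω $(h.complex.integrable y z) x)
  have hskew₁ := h.apply_J_left ⁅x, J y⁆ z
  have hskew₂ := h.apply_J_left ⁅J z, x⁆ y
  rw [map_sub, LinearMap.sub_apply, h.metric_J_left hgω]
  simp only [hgω, map_sub, map_zero, LinearMap.sub_apply, LinearMap.zero_apply,
    h.compatible] at *
  linarith

theorem leviCivita_bianchi (hg : g.Nondegenerate) (x y z : 𝔤) :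
    curvature g hg x y z + curvature g hg y z x + curvature g hg z x y = 0 := by
  have hjacobi := lie_jacobi x y z
  have hlie (a b c : 𝔤) : ⁅a, ⁅b, c⁆⁆ = leviCivita g hg a (leviCivita g hg b c) -
      leviCivita g hg a (leviCivita g hg c b) - leviCivita g hg ⁅b, c⁆ a := by
    rw [← map_sub, leviCivita_sub_leviCivita, leviCivita_sub_leviCivita]
  rw [hlie, hlie, hlie] at hjacobi
  simp only [curvature, LinearMap.sub_apply, Ring.lie_def, Module.End.mul_apply]
  rw [← hjacobi]
  abel

theorem trace_leviCivita_flip (hg : g.Nondegenerate) (hs : ∀ x y, g x y = g y x)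
    (hu : IsUnimodular 𝔤) (x : 𝔤) : LinearMap.trace ℝ 𝔤 ((leviCivita g hg).flip x) = 0 := by
  have hflip : (leviCivita g hg).flip x = leviCivita g hg x - LieAlgebra.ad ℝ 𝔤 x := by
    ext z
    simp [← leviCivita_sub_leviCivita hg x z]
  rw [hflip, map_sub, hu, trace_eq_zero_of_skew hg (leviCivita_skew hg hs x), sub_zero]

end KahlerGeometry

section NormalForm

open Complex

/-- The endomorphism `y ↦ g(a, y) b - g(b, y) a`, often written `a ∧ b`. It is skew for `g` when `g`
is symmetric, and the metric connections in question take values in its multiples. -/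
def skewRankTwo {R V : Type*} [CommRing R] [AddCommGroup V] [Module R V]
    (g : LinearMap.BilinForm R V) (a b : V) : Module.End R V :=
  (g a).smulRight b - (g b).smulRight a

theorem skewRankTwo_apply {R V : Type*} [CommRing R] [AddCommGroup V] [Module R V]
    (g : LinearMap.BilinForm R V) (a b y : V) :
    skewRankTwo g a b y = g a y • b - g b y • a := rfl

/-- The complex vector space structure in which `i` acts as an endomorphism with square `-1`. -/
abbrev complexModule {E : Type*} [AddCommGroup E] [Module ℝ E] (J : Module.End ℝ E)
    (hJ : J * J = -1) : Module ℂ E :=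
  Module.compHom E (Complex.liftAux J hJ).toRingHom

variable {𝔤 : Type*} [LieRing 𝔤] [LieAlgebra ℝ 𝔤] [FiniteDimensional ℝ 𝔤]
  {g : LinearMap.BilinForm ℝ 𝔤}

/-- The Levi-Civita connection, regarded as a connection on a complex vector space for which
multiplication by `i` is parallel. -/
def complexLeviCivita [Module ℂ 𝔤] [IsScalarTower ℝ ℂ 𝔤] (hg : g.Nondegenerate)
    (hpar : ∀ x y, leviCivita g hg x (I • y) = I • leviCivita g hg x y) :
    𝔤 →ₗ[ℝ] Module.End ℂ 𝔤 where
  toFun x :=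
    { toFun := leviCivita g hg x
      map_add' := map_add _
      map_smul' c y := by
        rw [map_smul_eq_re_smul_add_im_smul, hpar, RingHom.id_apply,
          smul_eq_re_smul_add_im_smul c (_ : 𝔤)] }
  map_add' x y := by ext; simp
  map_smul' c x := by ext; simp

theorem complexLeviCivita_apply [Module ℂ 𝔤] [IsScalarTower ℝ ℂ 𝔤] {hg : g.Nondegenerate}
    {hpar : ∀ x y, leviCivita g hg x (I • y) = I • leviCivita g hg x y} (x y : 𝔤) :
    complexLeviCivita hg hpar x y = leviCivita g hg x y := rfl

theorem complexLeviCivita_bianchi [Module ℂ 𝔤] [IsScalarTower ℝ ℂ 𝔤] {hg : g.Nondegenerate}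
    {hpar : ∀ x y, leviCivita g hg x (I • y) = I • leviCivita g hg x y} (x y z : 𝔤) :
    productCurvature (complexLeviCivita hg hpar) x y z +
      productCurvature (complexLeviCivita hg hpar) y z x +
      productCurvature (complexLeviCivita hg hpar) z x y = 0 := by
  simp only [productCurvature, complexLeviCivita_apply, leviCivita_sub_leviCivita]
  exact leviCivita_bianchi hg x y z

theorem exists_leviCivita_eq_of_complex [Module ℂ 𝔤] [IsScalarTower ℝ ℂ 𝔤]
    (hd : Module.finrank ℝ 𝔤 = 4) (hu : IsUnimodular 𝔤) (hg : g.Nondegenerate)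
    (hs : ∀ x y, g x y = g y x) (hI : ∀ x y, g (I • x) y = -g x (I • y))
    (hpar : ∀ x y, leviCivita g hg x (I • y) = I • leviCivita g hg x y) :
    ∃ (e : 𝔤) (l : Module.Dual ℝ 𝔤), l e = 0 ∧ l (I • e) = 0 ∧
      ∀ x y, leviCivita g hg x y = l x • skewRankTwo g e (I • e) y := by
  have hd₂ : Module.finrank ℂ 𝔤 = 2 := by
    have := Module.finrank_mul_finrank ℝ ℂ 𝔤
    rw [Complex.finrank_real_complex, hd] at this
    lia
  obtain ⟨e, l, hle, hlIe, hD⟩ := exists_rank_one_of_bianchi (D := complexLeviCivita hg hpar) hd₂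
    (hermitianForm_isSymm (hI := hI) hs) (hermitianForm_nondegenerate hg)
    (fun x => hermitianForm_skew (leviCivita_skew hg hs x)) complexLeviCivita_bianchi
    (trace_leviCivita_flip hg hs hu)
  refine ⟨e, l, hle, hlIe, fun x y => ?_⟩
  have hre : (I * hermitianForm g hI e y).re = -g (I • e) y := by simp [hermitianForm_apply, hI]
  have him : (I * hermitianForm g hI e y).im = g e y := by simp [hermitianForm_apply]
  rw [← complexLeviCivita_apply (hpar := hpar), hD, skewRankTwo_apply,
    smul_eq_re_smul_add_im_smul (_ * _), hre, him]
  module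

theorem IsKahlerStructure.exists_leviCivita_eq {J : 𝔤 →ₗ[ℝ] 𝔤} {ω : LinearMap.BilinForm ℝ 𝔤}
    (h : IsKahlerStructure J ω) (hgω : ∀ x y, g x y = ω (J x) y) (hg : g.Nondegenerate)
    (hs : ∀ x y, g x y = g y x) (hd : Module.finrank ℝ 𝔤 = 4) (hu : IsUnimodular 𝔤) :
    ∃ (e : 𝔤) (l : Module.Dual ℝ 𝔤), l e = 0 ∧ l (J e) = 0 ∧
      ∀ x y, leviCivita g hg x y = l x • skewRankTwo g e (J e) y := by
  have hJ : J * J = -1 := LinearMap.ext h.complex.sq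
  let : Module ℂ 𝔤 := complexModule J hJ
  have hsmul (c : ℂ) (x : 𝔤) : c • x = c.re • x + c.im • J x := by
    change Complex.liftAux J hJ c x = _
    simp [Complex.liftAux_apply]
  have : IsScalarTower ℝ ℂ 𝔤 := ⟨fun r c x => by simp [hsmul, smul_smul]⟩
  have hI (x : 𝔤) : J x = I • x := by simp [hsmul]
  simp only [hI]
  refine exists_leviCivita_eq_of_complex hd hu hg hs (fun x y => ?_) fun x y => ?_
  · simpa only [hI] using h.metric_J_left hgω x y
  · simpa only [hI] using h.leviCivita_J hgω hg x y

end NormalForm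

section Geodesics

theorem exists_hasDerivAt_apply_eq {E : Type*} [AddCommGroup E] [Module ℝ E]
    [FiniteDimensional ℝ E] (T : Module.End ℝ E) (x₀ : E) :
    ∃ x : ℝ → E, x 0 = x₀ ∧
      ∀ (φ : Module.Dual ℝ E) (t : ℝ), HasDerivAt (fun s => φ (x s)) (φ (T (x t))) t := by
  let e := (Module.finBasis ℝ E).equivFun
  let A := LinearMap.toContinuousLinearMap (e.conj T)
  refine ⟨fun t => e.symm (NormedSpace.exp (t • A) (e x₀)), by simp, fun φ t => ?_⟩
  have hexp := (hasDerivAt_exp_smul_const' (𝕂 := ℝ) A t).clm_apply (hasDerivAt_const t (e x₀))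
  let ψ := LinearMap.toContinuousLinearMap (φ ∘ₗ e.symm.toLinearMap)
  refine (ψ.hasFDerivAt.comp_hasDerivAt t hexp).congr_deriv ?_
  simp [A, ψ, LinearEquiv.conj_apply]

variable {𝔤 : Type*} [LieRing 𝔤] [LieAlgebra ℝ 𝔤] [FiniteDimensional ℝ 𝔤]
  {g : LinearMap.BilinForm ℝ 𝔤} {hg : g.Nondegenerate} {l : Module.Dual ℝ 𝔤}
  {M : Module.End ℝ 𝔤}

theorem isFlat_of_leviCivita_eq (hl : ∀ y, l (M y) = 0)
    (hM : ∀ x y, leviCivita g hg x y = l x • M y) : IsFlat g hg := by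
  intro x y
  have hlie : l ⁅x, y⁆ = 0 := by
    rw [← leviCivita_sub_leviCivita hg, hM, hM, map_sub, map_smul, map_smul, hl, hl, smul_zero,
      smul_zero, sub_self]
  ext z
  simp only [curvature, Ring.lie_def, Module.End.mul_apply, hM, map_smul, LinearMap.sub_apply,
    hlie, zero_smul, LinearMap.zero_apply, smul_comm (l x) (l y), sub_self]

theorem isGeodesicallyComplete_of_leviCivita_eq (hl : ∀ y, l (M y) = 0)
    (hM : ∀ x y, leviCivita g hg x y = l x • M y) : IsGeodesicallyComplete g hg := by
  intro x₀
  obtain ⟨x, hx₀, hx⟩ := exists_hasDerivAt_apply_eq (-(l x₀ • M)) x₀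
  have hlx (t : ℝ) : l (x t) = l x₀ := by
    have hderiv (t : ℝ) : HasDerivAt (fun s => l (x s)) 0 t := by simpa [hl] using hx l t
    rw [← hx₀]
    exact is_const_of_deriv_eq_zero (fun t => (hderiv t).differentiableAt)
      (fun t => (hderiv t).deriv) t 0
  refine ⟨x, hx₀, fun φ t => ?_⟩
  rw [hM, hlx]
  exact hx φ t

end Geodesics

section BracketTables

/-- The bracket `⁅e₀, e₁⁆ = δ e₂`, `⁅e₀, e₂⁆ = -ε e₁` on `ℝ⁴`, with `e₃` central and `e₁`, `e₂`
commuting. It is that of `ℝ × 𝔥₃` for `(δ, ε) = (1, 0)` and that of `ℝ × 𝔢(2)` for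
`(δ, ε) = (1, 1)`. -/
def tableBracket (δ ε : ℝ) (v w : Fin 4 → ℝ) : Fin 4 → ℝ :=
  ![0, -(ε * (v 0 * w 2 - v 2 * w 0)), δ * (v 0 * w 1 - v 1 * w 0), 0]

variable {𝔤 𝔥 : Type*} [LieRing 𝔤] [LieAlgebra ℝ 𝔤] [LieRing 𝔥] [LieAlgebra ℝ 𝔥] {δ ε : ℝ}

/-- In the coordinates `E` the Lie bracket of `𝔤` is `tableBracket δ ε`. -/
def IsBracketTable (δ ε : ℝ) (E : 𝔤 ≃ₗ[ℝ] (Fin 4 → ℝ)) : Prop :=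
  ∀ x y, E ⁅x, y⁆ = tableBracket δ ε (E x) (E y)

theorem IsBracketTable.nonempty_lieEquiv {E : 𝔤 ≃ₗ[ℝ] (Fin 4 → ℝ)} {F : 𝔥 ≃ₗ[ℝ] (Fin 4 → ℝ)}
    (hE : IsBracketTable δ ε E) (hF : IsBracketTable δ ε F) : Nonempty (𝔤 ≃ₗ⁅ℝ⁆ 𝔥) :=
  ⟨{ E.trans F.symm with
      map_lie' := fun {x y} => F.injective <| by
        change F (F.symm (E ⁅x, y⁆)) = F ⁅F.symm (E x), F.symm (E y)⁆
        rw [hF, hE, F.apply_symm_apply, F.apply_symm_apply, F.apply_symm_apply] }⟩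

theorem IsBracketTable.comp {F : 𝔥 ≃ₗ[ℝ] (Fin 4 → ℝ)} (hF : IsBracketTable δ ε F)
    (T : 𝔤 ≃ₗ⁅ℝ⁆ 𝔥) : IsBracketTable δ ε (T.toLinearEquiv.trans F) := fun x y => by
  change F (T ⁅x, y⁆) = _
  rw [LieEquiv.map_lie, hF]
  rfl

theorem isBracketTable_of_isLieAbelian [IsLieAbelian 𝔤] (E : 𝔤 ≃ₗ[ℝ] (Fin 4 → ℝ)) :
    IsBracketTable 0 0 E := fun x y => by
  rw [trivial_lie_zero, map_zero]
  ext i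
  fin_cases i <;> simp [tableBracket]

theorem IsBracketTable.isUnimodular {E : 𝔤 ≃ₗ[ℝ] (Fin 4 → ℝ)} (hE : IsBracketTable δ ε E) :
    IsUnimodular 𝔤 := fun x => by
  rw [LinearMap.trace_eq_matrix_trace ℝ (Module.Basis.ofEquivFun E), Matrix.trace]
  simp [Fin.sum_univ_four, LinearMap.toMatrix_apply, hE x _, tableBracket]

theorem isKahlerLieAlgebra_of_coordinates {V : Type*} [AddCommGroup V] [Module ℝ V]
    (E : 𝔤 ≃ₗ[ℝ] V) {β : V → V → V} (hE : ∀ x y, E ⁅x, y⁆ = β (E x) (E y)) {J : V →ₗ[ℝ] V}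
    {ω : LinearMap.BilinForm ℝ V} (hJ : ∀ v, J (J v) = -v)
    (hnijenhuis : ∀ v w, β (J v) (J w) - β v w - J (β (J v) w) - J (β v (J w)) = 0)
    (halt : ∀ v, ω v v = 0) (hclosed : ∀ u v w, ω (β u v) w + ω (β v w) u + ω (β w u) v = 0)
    (hnd : ω.Nondegenerate) (hJω : ∀ v w, ω (J v) (J w) = ω v w) : IsKahlerLieAlgebra 𝔤 := by
  refine ⟨E.symm.toLinearMap ∘ₗ J ∘ₗ E.toLinearMap, ω.congr E.symm,
    ⟨fun x => by simp [hJ], fun x y => E.injective ?_⟩,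
    ⟨fun x => by simp [halt], fun x y z => ?_, ?_⟩, fun x y => by simp [hJω]⟩
  · simpa [hE] using hnijenhuis (E x) (E y)
  · simpa [hE] using hclosed (E x) (E y) (E z)
  · simpa using hnd

/-- The complex structure `e₀ ↦ e₁`, `e₂ ↦ e₃` on `ℝ⁴`, integrable for `tableBracket δ 0`. -/
def heisenbergComplexStructure : (Fin 4 → ℝ) →ₗ[ℝ] (Fin 4 → ℝ) :=
  Matrix.toLin' !![0, -1, 0, 0; 1, 0, 0, 0; 0, 0, 0, -1; 0, 0, 1, 0]

/-- The form `e⁰ ∧ e² + e¹ ∧ e³` on `ℝ⁴`, closed for `tableBracket δ 0`. -/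
def heisenbergSymplecticForm : LinearMap.BilinForm ℝ (Fin 4 → ℝ) :=
  Matrix.toBilin' !![0, 0, 1, 0; 0, 0, 0, 1; -1, 0, 0, 0; 0, -1, 0, 0]

/-- The complex structure `e₁ ↦ e₂`, `e₀ ↦ e₃` on `ℝ⁴`, integrable for `tableBracket δ δ`. -/
def euclideanComplexStructure : (Fin 4 → ℝ) →ₗ[ℝ] (Fin 4 → ℝ) :=
  Matrix.toLin' !![0, 0, 0, -1; 0, 0, -1, 0; 0, 1, 0, 0; 1, 0, 0, 0]

/-- The form `e⁰ ∧ e³ + e¹ ∧ e²` on `ℝ⁴`, closed for `tableBracket δ δ`. -/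
def euclideanSymplecticForm : LinearMap.BilinForm ℝ (Fin 4 → ℝ) :=
  Matrix.toBilin' !![0, 0, 0, 1; 0, 0, 1, 0; 0, -1, 0, 0; -1, 0, 0, 0]

theorem heisenbergComplexStructure_apply (v : Fin 4 → ℝ) :
    heisenbergComplexStructure v = ![-v 1, v 0, -v 3, v 2] := by
  ext i
  fin_cases i <;>
    simp [heisenbergComplexStructure, Matrix.mulVec, dotProduct, Fin.sum_univ_four]

theorem heisenbergSymplecticForm_apply (v w : Fin 4 → ℝ) :
    heisenbergSymplecticForm v w = v 0 * w 2 + v 1 * w 3 - v 2 * w 0 - v 3 * w 1 := by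
  simp only [heisenbergSymplecticForm, Matrix.toBilin'_apply, Fin.sum_univ_four, Matrix.of_apply,
    Matrix.cons_val]
  ring

theorem heisenbergSymplecticForm_nondegenerate : heisenbergSymplecticForm.Nondegenerate := by
  refine LinearMap.BilinForm.nondegenerate_toBilin'_of_det_ne_zero' _ ?_
  simp [Matrix.det_succ_row_zero, Fin.sum_univ_succ, Fin.succAbove]

theorem euclideanComplexStructure_apply (v : Fin 4 → ℝ) :
    euclideanComplexStructure v = ![-v 3, -v 2, v 1, v 0] := by
  ext i
  fin_cases i <;>
    simp [euclideanComplexStructure, Matrix.mulVec, dotProduct, Fin.sum_univ_four]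

theorem euclideanSymplecticForm_apply (v w : Fin 4 → ℝ) :
    euclideanSymplecticForm v w = v 0 * w 3 + v 1 * w 2 - v 2 * w 1 - v 3 * w 0 := by
  simp only [euclideanSymplecticForm, Matrix.toBilin'_apply, Fin.sum_univ_four, Matrix.of_apply,
    Matrix.cons_val]
  ring

theorem euclideanSymplecticForm_nondegenerate : euclideanSymplecticForm.Nondegenerate := by
  refine LinearMap.BilinForm.nondegenerate_toBilin'_of_det_ne_zero' _ ?_
  simp [Matrix.det_succ_row_zero, Fin.sum_univ_succ, Fin.succAbove]

theorem IsBracketTable.isKahlerLieAlgebra_of_heisenberg {E : 𝔤 ≃ₗ[ℝ] (Fin 4 → ℝ)}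
    (hE : IsBracketTable δ 0 E) : IsKahlerLieAlgebra 𝔤 := by
  refine isKahlerLieAlgebra_of_coordinates E hE (J := heisenbergComplexStructure)
    (fun v => ?_) (fun v w => ?_) (fun v => ?_) (fun u v w => ?_)
    heisenbergSymplecticForm_nondegenerate fun v w => ?_
  · ext i; fin_cases i <;> simp [heisenbergComplexStructure_apply]
  · ext i
    fin_cases i <;> simp [heisenbergComplexStructure_apply, tableBracket] <;> ring
  · rw [heisenbergSymplecticForm_apply]
    ring
  · simp only [heisenbergSymplecticForm_apply, tableBracket, Matrix.cons_val]
    ring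
  · simp only [heisenbergSymplecticForm_apply, heisenbergComplexStructure_apply, Matrix.cons_val]
    ring

theorem IsBracketTable.isKahlerLieAlgebra_of_euclidean {E : 𝔤 ≃ₗ[ℝ] (Fin 4 → ℝ)}
    (hE : IsBracketTable δ δ E) : IsKahlerLieAlgebra 𝔤 := by
  refine isKahlerLieAlgebra_of_coordinates E hE (J := euclideanComplexStructure)
    (fun v => ?_) (fun v w => ?_) (fun v => ?_) (fun u v w => ?_)
    euclideanSymplecticForm_nondegenerate fun v w => ?_
  · ext i; fin_cases i <;> simp [euclideanComplexStructure_apply]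
  · ext i
    fin_cases i <;> simp [euclideanComplexStructure_apply, tableBracket] <;> ring
  · rw [euclideanSymplecticForm_apply]
    ring
  · simp only [euclideanSymplecticForm_apply, tableBracket, Matrix.cons_val]
    ring
  · simp only [euclideanSymplecticForm_apply, euclideanComplexStructure_apply, Matrix.cons_val]
    ring

end BracketTables

section Models

/-- The coordinates `(A₀₁, A₁₂, A₀₂, r)` of `(r, A)` in `ℝ × 𝔥₃`. -/
def heisenbergCoordinates : (ℝ × heisenberg3) ≃ₗ[ℝ] (Fin 4 → ℝ) where
  toFun p := ![p.2.1 0 1, p.2.1 1 2, p.2.1 0 2, p.1]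
  map_add' p q := by ext i; fin_cases i <;> simp
  map_smul' c p := by ext i; fin_cases i <;> simp
  invFun v := (v 3, ⟨!![0, v 0, v 2; 0, 0, v 1; 0, 0, 0], fun i j h => by
    fin_cases i <;> fin_cases j <;> simp at h ⊢⟩)
  left_inv := fun ⟨r, A, hA⟩ => by
    have lower_eq_zero : ∀ i j, j ≤ i → A i j = 0 := hA
    refine Prod.ext (by simp) (Subtype.ext ?_)
    ext i j
    fin_cases i <;> fin_cases j <;> simp [lower_eq_zero]
  right_inv v := by ext i; fin_cases i <;> simp

theorem isBracketTable_heisenberg : IsBracketTable 1 0 heisenbergCoordinates := by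
  rintro ⟨r, A, hA : ∀ i j, j ≤ i → A i j = 0⟩ ⟨s, B, hB : ∀ i j, j ≤ i → B i j = 0⟩
  change ![(A * B - B * A) 0 1, (A * B - B * A) 1 2, (A * B - B * A) 0 2, r * s - s * r] = _
  ext i
  fin_cases i <;>
    simp [heisenbergCoordinates, tableBracket, Matrix.mul_apply, Fin.sum_univ_three, hA, hB] <;>
    ring

/-- The coordinates `(A₁₀, A₀₂, A₁₂, r)` of `(r, A)` in `ℝ × 𝔢(2)`. -/
def euclideanCoordinates : (ℝ × euclidean2) ≃ₗ[ℝ] (Fin 4 → ℝ) where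
  toFun p := ![p.2.1 1 0, p.2.1 0 2, p.2.1 1 2, p.1]
  map_add' p q := by ext i; fin_cases i <;> simp
  map_smul' c p := by ext i; fin_cases i <;> simp
  invFun v := (v 3, ⟨!![0, -v 0, v 1; v 0, 0, v 2; 0, 0, 0], by simp, by simp, by simp,
    fun j => by fin_cases j <;> simp⟩)
  left_inv := fun ⟨r, A, h₀₀, h₁₁, h₀₁, h₂⟩ => by
    refine Prod.ext (by simp) (Subtype.ext ?_)
    ext i j
    fin_cases i <;> fin_cases j <;> simp [h₀₀, h₁₁, h₀₁, h₂]
  right_inv v := by ext i; fin_cases i <;> simp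

theorem isBracketTable_euclidean : IsBracketTable 1 1 euclideanCoordinates := by
  rintro ⟨r, A, hA₀₀, hA₁₁, hA₀₁, hA₂⟩ ⟨s, B, hB₀₀, hB₁₁, hB₀₁, hB₂⟩
  change ![(A * B - B * A) 1 0, (A * B - B * A) 0 2, (A * B - B * A) 1 2, r * s - s * r] = _
  ext i
  fin_cases i <;>
    simp [euclideanCoordinates, tableBracket, Matrix.mul_apply, Fin.sum_univ_three, hA₀₀, hA₁₁,
      hA₀₁, hA₂, hB₀₀, hB₁₁, hB₀₁, hB₂] <;>
    ring

end Models

section SkewEndomorphism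

theorem linearIndependent_cons_of_map {K V W : Type*} [DivisionRing K] [AddCommGroup V]
    [Module K V] [AddCommGroup W] [Module K W] {n : ℕ} {v : Fin n → V} {x : V} (f : V →ₗ[K] W)
    (hv : LinearIndependent K v) (hfv : ∀ i, f (v i) = 0) (hfx : f x ≠ 0) :
    LinearIndependent K (Matrix.vecCons x v) := by
  refine linearIndependent_finCons.2 ⟨hv, fun hx => hfx ?_⟩
  have hspan : Submodule.span K (Set.range v) ≤ LinearMap.ker f :=
    Submodule.span_le.2 (Set.range_subset_iff.2 hfv)
  exact hspan hx

theorem eq_zero_of_skew_of_ker_le {K V : Type*} [Field K] [NeZero (2 : K)] [AddCommGroup V]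
    [Module K V] {g : LinearMap.BilinForm K V} (hg : g.Nondegenerate) (hs : ∀ x y, g x y = g y x)
    {M : Module.End K V} (hM : ∀ x y, g (M x) y = -g x (M y)) {l : Module.Dual K V}
    (hl : LinearMap.ker l ≤ LinearMap.ker M) : M = 0 := by
  rcases eq_or_ne l 0 with rfl | hl₀
  · exact LinearMap.ext fun x => hl (x := x) rfl
  obtain ⟨u, hu⟩ := LinearMap.surjective hl₀ 1
  have hMl (x : V) : M x = l x • M u := by
    have hker : x - l x • u ∈ LinearMap.ker M := hl (by simp [hu])
    simpa [sub_eq_zero] using hker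
  have huMu : g u (M u) = 0 := by
    have hself := hM u u
    rw [hs, eq_neg_iff_add_eq_zero, ← two_mul] at hself
    exact (mul_eq_zero.1 hself).resolve_left two_ne_zero
  have hMu : M u = 0 := hg.1 _ fun y => by rw [hM, hMl y, map_smul, huMu, smul_zero, neg_zero]
  ext x
  rw [hMl, hMu, smul_zero, LinearMap.zero_apply]

theorem linearIndependent_pair_of_sq_eq_neg {K V : Type*} [Field K] [LinearOrder K]
    [IsStrictOrderedRing K] [AddCommGroup V] [Module K V] {J : Module.End K V}
    (hJ : ∀ x, J (J x) = -x) {e : V} (he : e ≠ 0) : LinearIndependent K ![e, J e] := by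
  refine (LinearIndependent.pair_iff' he).2 fun c hc => he ?_
  have hsq : (c ^ 2 + 1) • e = 0 := by
    rw [add_smul, one_smul, pow_two, mul_smul, hc, ← map_smul, hc, hJ, neg_add_cancel]
  exact (smul_eq_zero.1 hsq).resolve_left (by positivity)

section SkewRankTwo

variable {R V : Type*} [CommRing R] [AddCommGroup V] [Module R V] {g : LinearMap.BilinForm R V}
  {a b : V}

theorem apply_skewRankTwo_eq_zero {l : Module.Dual R V} (ha : l a = 0) (hb : l b = 0) (y : V) :
    l (skewRankTwo g a b y) = 0 := by
  simp [skewRankTwo_apply, ha, hb]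

theorem skewRankTwo_skew (hs : ∀ x y, g x y = g y x) (x y : V) :
    g (skewRankTwo g a b x) y = -g x (skewRankTwo g a b y) := by
  simp only [skewRankTwo_apply, map_sub, map_smul, LinearMap.sub_apply, LinearMap.smul_apply,
    smul_eq_mul, hs x]
  ring

theorem skewRankTwo_ne_zero [Nontrivial R] (hg : g.Nondegenerate)
    (hab : LinearIndependent R ![a, b]) : skewRankTwo g a b ≠ 0 := by
  intro h
  refine hab.ne_zero 0 (hg.1 _ fun y => ?_)
  have hy : -g b y • a + g a y • b = 0 := by
    rw [neg_smul, neg_add_eq_sub, ← skewRankTwo_apply, h, LinearMap.zero_apply]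
  exact (LinearIndependent.pair_iff.1 hab _ _ hy).2

end SkewRankTwo

variable {E : Type*} [AddCommGroup E] [Module ℝ E] {g : LinearMap.BilinForm ℝ E}
  {J : Module.End ℝ E} {e : E}

theorem metric_apply_J_self (hs : ∀ x y, g x y = g y x) (hgJ : ∀ x y, g (J x) y = -g x (J y))
    (x : E) : g x (J x) = 0 := by
  have := hgJ x x
  rw [hs] at this
  linarith

theorem skewRankTwo_J_self (hs : ∀ x y, g x y = g y x) (hgJ : ∀ x y, g (J x) y = -g x (J y)) :
    skewRankTwo g e (J e) e = g e e • J e := by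
  rw [skewRankTwo_apply, hs (J e), metric_apply_J_self hs hgJ, zero_smul, sub_zero]

theorem skewRankTwo_J_comm (hJ : ∀ x, J (J x) = -x) (hgJ : ∀ x y, g (J x) y = -g x (J y))
    (y : E) : skewRankTwo g e (J e) (J y) = J (skewRankTwo g e (J e) y) := by
  simp only [skewRankTwo_apply, map_sub, map_smul, hgJ, hJ, map_neg]
  module

theorem skewRankTwo_J_sq_eq_zero (hs : ∀ x y, g x y = g y x) (hJ : ∀ x, J (J x) = -x)
    (hgJ : ∀ x y, g (J x) y = -g x (J y)) (he : g e e = 0) (y : E) :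
    skewRankTwo g e (J e) (skewRankTwo g e (J e) y) = 0 := by
  rw [skewRankTwo_apply g e (J e) y, map_sub, map_smul, map_smul, skewRankTwo_J_comm hJ hgJ,
    skewRankTwo_J_self hs hgJ, he, zero_smul, map_zero, smul_zero, smul_zero, sub_zero]

end SkewEndomorphism

section Classification

variable {𝔤 : Type*} [LieRing 𝔤] [LieAlgebra ℝ 𝔤] {l : Module.Dual ℝ 𝔤}

theorem isBracketTable_of_basis {M : Module.End ℝ 𝔤} {δ ε : ℝ}
    (h : ∀ x y : 𝔤, ⁅x, y⁆ = l x • M y - l y • M x) (b : Module.Basis (Fin 4) ℝ 𝔤)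
    (hl : ∀ i, i ≠ 0 → l (b i) = 0) (h₁ : l (b 0) • M (b 1) = δ • b 2)
    (h₂ : l (b 0) • M (b 2) = -(ε • b 1)) (h₃ : M (b 3) = 0) :
    IsBracketTable δ ε b.equivFun := by
  have hlb (x : 𝔤) : l x = b.equivFun x 0 * l (b 0) := by
    conv_lhs => rw [← b.sum_equivFun x, Fin.sum_univ_four]
    simp [hl]
  have hMb (x : 𝔤) : M x = b.equivFun x 0 • M (b 0) + b.equivFun x 1 • M (b 1) +
      b.equivFun x 2 • M (b 2) := by
    conv_lhs => rw [← b.sum_equivFun x, Fin.sum_univ_four]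
    simp only [map_add, map_smul, h₃, smul_zero, add_zero]
  intro x y
  rw [← LinearEquiv.eq_symm_apply, Module.Basis.equivFun_symm_apply, Fin.sum_univ_four, h, hlb x,
    hlb y, hMb x, hMb y]
  set v := b.equivFun x
  set w := b.equivFun y
  simp only [tableBracket, Matrix.cons_val]
  linear_combination (norm := module) (v 0 * w 1 - v 1 * w 0) • h₁ + (v 0 * w 2 - v 2 * w 0) • h₂

variable {g : LinearMap.BilinForm ℝ 𝔤} {J : Module.End ℝ 𝔤} {e : 𝔤}

theorem exists_isBracketTable_of_isotropic (hd : Module.finrank ℝ 𝔤 = 4) (hg : g.Nondegenerate)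
    (hs : ∀ x y, g x y = g y x) (hJ : ∀ x, J (J x) = -x) (hgJ : ∀ x y, g (J x) y = -g x (J y))
    (hle : l e = 0) (hlJe : l (J e) = 0) (hl : l ≠ 0) (he : e ≠ 0) (hee : g e e = 0)
    (h : ∀ x y : 𝔤, ⁅x, y⁆ = l x • skewRankTwo g e (J e) y - l y • skewRankTwo g e (J e) x) :
    ∃ E : 𝔤 ≃ₗ[ℝ] (Fin 4 → ℝ), IsBracketTable 1 0 E := by
  obtain ⟨u, hu⟩ := LinearMap.surjective hl 1
  have hM : skewRankTwo g e (J e) ≠ 0 :=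
    skewRankTwo_ne_zero hg (linearIndependent_pair_of_sq_eq_neg hJ he)
  have hMM := skewRankTwo_J_sq_eq_zero hs hJ hgJ hee
  have hMJ (y : 𝔤) := skewRankTwo_J_comm (e := e) hJ hgJ y
  have hlM (y : 𝔤) := apply_skewRankTwo_eq_zero (g := g) hle hlJe y
  have hskew (x y : 𝔤) := skewRankTwo_skew (a := e) (b := J e) hs x y
  set M := skewRankTwo g e (J e)
  obtain ⟨v, hlv, hv⟩ : ∃ v, l v = 0 ∧ M v ≠ 0 := by
    by_contra! hker
    exact hM (eq_zero_of_skew_of_ker_le hg hs hskew hker)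
  have hMJM : M (J (M v)) = 0 := by rw [hMJ, hMM, map_zero]
  have hlJM : l (J (M v)) = 0 := by rw [← hMJ, hlM]
  have hli : LinearIndependent ℝ ![u, v, M v, J (M v)] := by
    refine linearIndependent_cons_of_map l (linearIndependent_cons_of_map M
      (linearIndependent_pair_of_sq_eq_neg hJ hv) ?_ hv) ?_ (by simp [hu])
    · simp [Fin.forall_fin_two, hMM, hMJM]
    · simp [Fin.forall_fin_succ, hlv, hlM, hlJM]
  let b := basisOfLinearIndependentOfCardEqFinrank hli (by simp [hd])
  refine ⟨b.equivFun, isBracketTable_of_basis h b ?_ ?_ ?_ ?_⟩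
  · simp [Fin.forall_fin_succ, b, hlv, hlM, hlJM]
  · simp [b, hu]
  · simp [b, hMM]
  · simp [b, hMJM]

theorem exists_isBracketTable_of_anisotropic [FiniteDimensional ℝ 𝔤]
    (hd : Module.finrank ℝ 𝔤 = 4) (hs : ∀ x y, g x y = g y x) (hJ : ∀ x, J (J x) = -x)
    (hgJ : ∀ x y, g (J x) y = -g x (J y)) (hle : l e = 0)
    (hlJe : l (J e) = 0) (hl : l ≠ 0) (hee : g e e ≠ 0)
    (h : ∀ x y : 𝔤, ⁅x, y⁆ = l x • skewRankTwo g e (J e) y - l y • skewRankTwo g e (J e) x) :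
    ∃ E : 𝔤 ≃ₗ[ℝ] (Fin 4 → ℝ), IsBracketTable 1 1 E := by
  obtain ⟨u, hu⟩ := LinearMap.surjective hl (g e e)⁻¹
  obtain ⟨v, hv, hv₀⟩ : ∃ v ∈ LinearMap.ker (LinearMap.pi ![l, g e, g (J e)]), v ≠ 0 :=
    (Submodule.ne_bot_iff _).1 (LinearMap.ker_ne_bot_of_finrank_lt (by simp [hd]))
  obtain ⟨hlv, hev, hJev⟩ : l v = 0 ∧ g e v = 0 ∧ g (J e) v = 0 :=
    ⟨congrFun hv 0, congrFun hv 1, congrFun hv 2⟩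
  have heJe : g e (J e) = 0 := metric_apply_J_self hs hgJ e
  have hJeJe : g (J e) (J e) = g e e := by rw [hgJ, hJ, map_neg, neg_neg]
  have hMe := skewRankTwo_J_self (e := e) hs hgJ
  have hMJe : skewRankTwo g e (J e) (J e) = -(g e e • e) := by
    rw [skewRankTwo_J_comm hJ hgJ, hMe, map_smul, hJ, smul_neg]
  have hMv : skewRankTwo g e (J e) v = 0 := by
    rw [skewRankTwo_apply, hev, hJev, zero_smul, zero_smul, sub_zero]
  have hli : LinearIndependent ℝ ![u, e, J e, v] := by
    refine linearIndependent_cons_of_map l (linearIndependent_cons_of_map (g e)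
      (linearIndependent_cons_of_map (g (J e)) (v := ![v]) ?_ ?_ ?_) ?_ hee) ?_ ?_
    · exact linearIndependent_unique_iff.2 hv₀
    · simpa using hJev
    · rwa [hJeJe]
    · simp [Fin.forall_fin_two, heJe, hev]
    · simp [Fin.forall_fin_succ, hle, hlJe, hlv]
    · rw [hu]; exact inv_ne_zero hee
  let b := basisOfLinearIndependentOfCardEqFinrank hli (by simp [hd])
  refine ⟨b.equivFun, isBracketTable_of_basis h b ?_ ?_ ?_ ?_⟩
  · simp [Fin.forall_fin_succ, b, hle, hlJe, hlv]
  · simp [b, hu, hMe, smul_smul, hee]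
  · simp [b, hu, hMJe, smul_smul, hee]
  · simpa [b] using hMv

theorem isLieAbelian_or_exists_isBracketTable_of_lie_eq [FiniteDimensional ℝ 𝔤]
    (hd : Module.finrank ℝ 𝔤 = 4) (hg : g.Nondegenerate) (hs : ∀ x y, g x y = g y x)
    (hJ : ∀ x, J (J x) = -x) (hgJ : ∀ x y, g (J x) y = -g x (J y))
    (hle : l e = 0) (hlJe : l (J e) = 0)
    (h : ∀ x y : 𝔤, ⁅x, y⁆ = l x • skewRankTwo g e (J e) y - l y • skewRankTwo g e (J e) x) :
    IsLieAbelian 𝔤 ∨ (∃ E : 𝔤 ≃ₗ[ℝ] (Fin 4 → ℝ), IsBracketTable 1 0 E) ∨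
      ∃ E : 𝔤 ≃ₗ[ℝ] (Fin 4 → ℝ), IsBracketTable 1 1 E := by
  rcases eq_or_ne l 0 with rfl | hl
  · exact Or.inl ⟨fun x y => by simp [h]⟩
  rcases eq_or_ne e 0 with rfl | he
  · exact Or.inl ⟨fun x y => by simp [h, skewRankTwo_apply]⟩
  right
  by_cases hee : g e e = 0
  · exact Or.inl (exists_isBracketTable_of_isotropic hd hg hs hJ hgJ hle hlJe hl he hee h)
  · exact Or.inr (exists_isBracketTable_of_anisotropic hd hs hJ hgJ hle hlJe hl hee h)

theorem IsKahlerLieAlgebra.isLieAbelian_or_exists_isBracketTable [FiniteDimensional ℝ 𝔤]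
    (h : IsKahlerLieAlgebra 𝔤) (hd : Module.finrank ℝ 𝔤 = 4) (hu : IsUnimodular 𝔤) :
    IsLieAbelian 𝔤 ∨ (∃ E : 𝔤 ≃ₗ[ℝ] (Fin 4 → ℝ), IsBracketTable 1 0 E) ∨
      ∃ E : 𝔤 ≃ₗ[ℝ] (Fin 4 → ℝ), IsBracketTable 1 1 E := by
  obtain ⟨J, ω, hk⟩ := h
  have hgω (x y : 𝔤) : (ω ∘ₗ J) x y = ω (J x) y := rfl
  have hg : IsPseudoKahlerMetric (ω ∘ₗ J) := ⟨J, ω, hk, hgω⟩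
  obtain ⟨e, l, hle, hlJe, hD⟩ := hk.exists_leviCivita_eq hgω hg.nondegenerate hg.symm hd hu
  refine isLieAbelian_or_exists_isBracketTable_of_lie_eq hd hg.nondegenerate hg.symm
    hk.complex.sq (hk.metric_J_left hgω) hle hlJe fun x y => ?_
  rw [← leviCivita_sub_leviCivita hg.nondegenerate, hD, hD]

end Classification

end PseudoKahler

theorem mainTheorem2 {𝔤 : Type*} [LieRing 𝔤] [LieAlgebra ℝ 𝔤] [FiniteDimensional ℝ 𝔤]
    (hdim : Module.finrank ℝ 𝔤 = 4) :
    (PseudoKahler.IsUnimodular 𝔤 →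
      ∀ (g : LinearMap.BilinForm ℝ 𝔤) (hg : PseudoKahler.IsPseudoKahlerMetric g),
        PseudoKahler.IsFlat g hg.nondegenerate ∧
        PseudoKahler.IsGeodesicallyComplete g hg.nondegenerate ∧
        (PseudoKahler.IsRicciFlat g hg.nondegenerate → PseudoKahler.IsFlat g hg.nondegenerate)) ∧
    ((PseudoKahler.IsUnimodular 𝔤 ∧ PseudoKahler.IsKahlerLieAlgebra 𝔤) ↔
      (IsLieAbelian 𝔤 ∨
        Nonempty (𝔤 ≃ₗ⁅ℝ⁆ ℝ × PseudoKahler.heisenberg3) ∨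
        Nonempty (𝔤 ≃ₗ⁅ℝ⁆ ℝ × PseudoKahler.euclidean2))) := by
  open PseudoKahler in
  refine ⟨fun hu g hg => ?_, fun ⟨hu, hk⟩ => ?_, ?_⟩
  · obtain ⟨J, ω, hk, hgω⟩ := id hg
    obtain ⟨e, l, hle, hlJe, hD⟩ := hk.exists_leviCivita_eq hgω hg.nondegenerate hg.symm hdim hu
    have hlM := apply_skewRankTwo_eq_zero (g := g) hle hlJe
    have hflat : IsFlat g hg.nondegenerate := isFlat_of_leviCivita_eq hlM hD
    exact ⟨hflat, isGeodesicallyComplete_of_leviCivita_eq hlM hD, fun _ => hflat⟩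
  · rcases hk.isLieAbelian_or_exists_isBracketTable hdim hu with h | ⟨E, hE⟩ | ⟨E, hE⟩
    · exact Or.inl h
    · exact Or.inr (Or.inl (hE.nonempty_lieEquiv isBracketTable_heisenberg))
    · exact Or.inr (Or.inr (hE.nonempty_lieEquiv isBracketTable_euclidean))
  · rintro (h | ⟨⟨T⟩⟩ | ⟨⟨T⟩⟩)
    · have hE := isBracketTable_of_isLieAbelian (Module.finBasisOfFinrankEq ℝ 𝔤 hdim).equivFun
      exact ⟨hE.isUnimodular, hE.isKahlerLieAlgebra_of_heisenberg⟩
    · have hE := isBracketTable_heisenberg.comp T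
      exact ⟨hE.isUnimodular, hE.isKahlerLieAlgebra_of_heisenberg⟩
    · have hE := isBracketTable_euclidean.comp T
      exact ⟨hE.isUnimodular, hE.isKahlerLieAlgebra_of_euclidean⟩

end
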